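/- Let $T$ be a complete first-order theory in a language $\mathcal L$, let $x$ be a (possibly infinite) tuple of variables and $\pi(x)$ a partial type over $\emptyset$ (defining a set $X$). For $M\models T$ let $S_X(M)$ be the compact space of complete types $p(x)$ over $M$ containing $\pi$, with the action $\sigma(p)=\{\varphi(x,\sigma(a)):\varphi(x,a)\in p\}$ of $\mathrm{Aut}(M)$. Let $E(S_X(M))$ be its Ellis semigroup, i.e. the closure of $\{p\mapsto\sigma(p):\sigma\in\mathrm{Aut}(M)\}$ in $S_X(M)^{S_X(M)}$ (pointwise convergence), with composition. For $\varphi_1(x,y),\dots,\varphi_n(x,y)\in\mathcal L$ with $y$ finite and $q\in S_y(\emptyset)$, let $R_{\bar\varphi,q}(p_1,\dots,p_n)$ hold on $S_X(M)$ iff there is no $b\models q$ in $M$ with $\varphi_i(x,b)\in p_i$ for all $i\le n$; these relations make $S_X(M)$, and each of its subsets, an infinitary definability patterns structure. For a minimal left ideal $\mathcal M$ of $E(S_X(M))$ and an idempotent $u\in\mathcal M$ put $\bar{\mathcal J}=\mathrm{Im}(u)$. The Ellis group $u\mathcal M$ carries the $\tau$-topology, whose closure operator is $\mathrm{cl}_\tau(B)=u\mathcal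 M\cap(u\circ B)$, where $u\circ B$ is the set of limits of nets $\sigma_ib_i$ with $\sigma_i\in\mathrm{Aut}(M)$, $b_i\in B$, $\lim\sigma_i=u$. The group $\mathrm{Aut}(\bar{\mathcal J})$ of automorphisms of the infinitary definability patterns structure $\bar{\mathcal J}$ carries the ipp-topology, which has as a subbasis of closed sets the sets $\{f: R_{\bar\varphi,r}(f(p_1),\dots,f(p_m),q_1,\dots,q_n)\}$ with $p_i,q_j\in\bar{\mathcal J}$. Let $M,N\models T$ be $\aleph_0$-saturated and strongly $\aleph_0$-homogeneous, let $u$ be an idempotent in a minimal left ideal $\mathcal M$ of $E(S_X(M))$, and $v$ an idempotent in a minimal left ideal $\mathcal N$ of $E(S_X(N))$. Then: 1. $\mathrm{Im}(u)$ and $\mathrm{Im}(v)$ are isomorphic as infinitary definability patterns structures. 2. $\eta\mapsto\eta|_{\mathrm{Im}(u)}$ is a group isomorphism and a homeomorphism from $u\mathcal M$ with the $\tau$-topology onto $\mathrm{Aut}(\mathrm{Im}(u))$ with the ipp-topology. 3. $u\mathcal M$ and $v\mathcal N$, with their $\tau$-topologies, are isomorphic by a group isomorphism that is a homeomorphism.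 -/

import Mathlib

set_option linter.unusedSectionVars false

open FirstOrder Filter Topology Cardinal

universe u v w w' w''

/-! ## Ellis semigroups, minimal left ideals, Ellis groups and the τ-topology -/

namespace TopDyn

section Semigroup

variable (G : Type*) (X : Type*) [Group G] [MulAction G X] [TopologicalSpace X]

/-- The Ellis semigroup `E(X)`: the closure, in `X → X` with the topology of pointwise convergence,
of the set of maps `x ↦ g • x`. Its operation is composition. -/
def ellisSemigroup : Set (X → X) :=
  closure (Set.range fun (g : G) (x : X) => g • x)

variable {X}

/-- `I` is a (nonempty) left ideal of the semigroup of maps `S`. -/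
structure IsLeftIdeal (S I : Set (X → X)) : Prop where
  nonempty : I.Nonempty
  subset : I ⊆ S
  comp_mem : ∀ η ∈ S, ∀ a ∈ I, η ∘ a ∈ I

variable (X)

/-- A minimal left ideal `ℳ` of `E(X)` together with an idempotent `u ∈ ℳ`. -/
structure MinimalIdempotent where
  /-- the minimal left ideal -/
  ideal : Set (X → X)
  isMinimal : Minimal (IsLeftIdeal (ellisSemigroup G X)) ideal
  /-- the idempotent -/
  u : X → X
  u_mem : u ∈ ideal
  idem : u ∘ u = u

variable {X}

/-- `a ∘ B`: the set of all limits of nets `g i • b i` with `g i ∈ G`, `b i ∈ B` and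
`lim g i = a`. The nets are given here by filters on the set of pairs `(g, b)`. -/
def circ (a : X → X) (B : Set (X → X)) : Set (X → X) :=
  {c | ∃ F : Filter (G × (X → X)), F.NeBot ∧ (∀ᶠ z in F, z.2 ∈ B) ∧
    Tendsto (fun z (x : X) => z.1 • x) F (𝓝 a) ∧
    Tendsto (fun z (x : X) => z.1 • z.2 x) F (𝓝 c)}

end Semigroup

section EllisGroup

variable {G : Type*} {X : Type*} [Group G] [MulAction G X] [TopologicalSpace X]

namespace MinimalIdempotent

/-- The set `uℳ`. -/
def ellisSet (c : MinimalIdempotent G X) : Set (X → X) :=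
  {η | ∃ a ∈ c.ideal, η = c.u ∘ a}

/-- The Ellis group `uℳ`: its elements are the maps in the set `uℳ`. -/
@[ext]
structure EllisGroup (c : MinimalIdempotent G X) where
  /-- the underlying map -/
  map : X → X
  mem : map ∈ c.ellisSet

variable (c : MinimalIdempotent G X)

theorem u_mem_ellis : c.u ∈ ellisSemigroup G X :=
  c.isMinimal.prop.subset c.u_mem

theorem ellisSet_subset : c.ellisSet ⊆ c.ideal := by
  rintro _ ⟨a, ha, rfl⟩
  exact c.isMinimal.prop.comp_mem _ c.u_mem_ellis _ ha

theorem u_comp {η : X → X} (h : η ∈ c.ellisSet) : c.u ∘ η = η := by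
  obtain ⟨a, -, rfl⟩ := h
  rw [← Function.comp_assoc, c.idem]

theorem comp_mem_ellisSet {η θ : X → X} (h : η ∈ c.ellisSet) (h' : θ ∈ c.ellisSet) :
    η ∘ θ ∈ c.ellisSet := by
  refine ⟨η ∘ θ, c.isMinimal.prop.comp_mem _ ?_ _ (c.ellisSet_subset h'), ?_⟩
  · exact c.isMinimal.prop.subset (c.ellisSet_subset h)
  · rw [← Function.comp_assoc, c.u_comp h]

theorem exists_left_inv {η : X → X} (h : η ∈ c.ellisSet) :
    ∃ θ ∈ c.ellisSet, θ ∘ η = c.u := by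
  have hmem := c.ellisSet_subset h
  have hI : IsLeftIdeal (ellisSemigroup G X) ((fun a => a ∘ η) '' c.ideal) := by
    refine ⟨⟨_, _, c.u_mem, rfl⟩, ?_, ?_⟩
    · rintro _ ⟨a, ha, rfl⟩
      exact c.isMinimal.prop.subset
        (c.isMinimal.prop.comp_mem _ (c.isMinimal.prop.subset ha) _ hmem)
    · rintro ζ hζ _ ⟨a, ha, rfl⟩
      exact ⟨ζ ∘ a, c.isMinimal.prop.comp_mem _ hζ _ ha, rfl⟩
  have hle : (fun a => a ∘ η) '' c.ideal ≤ c.ideal := by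
    rintro _ ⟨a, ha, rfl⟩
    exact c.isMinimal.prop.comp_mem _ (c.isMinimal.prop.subset ha) _ hmem
  obtain ⟨a, ha, hau⟩ := c.isMinimal.le_of_le hI hle c.u_mem
  refine ⟨c.u ∘ a, ⟨a, ha, rfl⟩, ?_⟩
  have hau' : a ∘ η = c.u := hau
  rw [Function.comp_assoc, hau', c.idem]

noncomputable instance : Mul c.EllisGroup :=
  ⟨fun η θ => ⟨η.map ∘ θ.map, c.comp_mem_ellisSet η.mem θ.mem⟩⟩

noncomputable instance : One c.EllisGroup :=
  ⟨⟨c.u, c.u, c.u_mem, c.idem.symm⟩⟩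

noncomputable instance : Inv c.EllisGroup :=
  ⟨fun η => ⟨(c.exists_left_inv η.mem).choose, (c.exists_left_inv η.mem).choose_spec.1⟩⟩

/-- The group structure of `uℳ`: composition of maps, with neutral element `u`. -/
noncomputable instance : Group c.EllisGroup :=
  Group.ofLeftAxioms (fun _ _ _ => rfl) (fun η => EllisGroup.ext (c.u_comp η.mem))
    (fun η => EllisGroup.ext (c.exists_left_inv η.mem).choose_spec.2)

/-- The closure operator `cl_τ(B) = uℳ ∩ (u ∘ B)`. -/
def tauClosure (B : Set (X → X)) : Set (X → X) :=
  c.ellisSet ∩ circ G c.u B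

theorem subset_tauClosure {B : Set (X → X)} (hB : B ⊆ c.ellisSet) : B ⊆ c.tauClosure B := by
  intro b hb
  refine ⟨hB hb, ?_⟩
  let e : G → X → X := fun g x => g • x
  have hne : (comap e (𝓝 c.u)).NeBot := by
    refine comap_neBot_iff.2 fun t ht => ?_
    obtain ⟨_, h1, g, rfl⟩ := mem_closure_iff_nhds.1 c.u_mem_ellis t ht
    exact ⟨g, h1⟩
  refine ⟨(comap e (𝓝 c.u)).map fun g => (g, b), inferInstance, ?_, ?_, ?_⟩
  · simp [hb]
  · rw [tendsto_map'_iff]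
    exact tendsto_comap
  · rw [tendsto_map'_iff]
    have h1 : Tendsto (fun f : X → X => f ∘ b) (𝓝 c.u) (𝓝 (c.u ∘ b)) :=
      Continuous.tendsto (continuous_pi fun x => continuous_apply (b x)) _
    rw [c.u_comp (hB hb)] at h1
    exact h1.comp tendsto_comap

theorem image_map_subset (B : Set c.EllisGroup) : EllisGroup.map '' B ⊆ c.ellisSet := by
  rintro _ ⟨θ, -, rfl⟩
  exact θ.mem

/-- The τ-topology on `uℳ`: a set `B` is closed iff `cl_τ(B) = B`. -/
instance : TopologicalSpace c.EllisGroup :=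
  TopologicalSpace.ofClosed {B | c.tauClosure (EllisGroup.map '' B) = EllisGroup.map '' B}
    (by
      refine Set.Subset.antisymm ?_ (c.subset_tauClosure (c.image_map_subset _))
      rintro η ⟨-, F, hF, h, -⟩
      simp at h
      exact absurd h hF.ne)
    (by
      intro A hA
      refine Set.Subset.antisymm ?_ (c.subset_tauClosure (c.image_map_subset _))
      rintro η ⟨hη, F, hF, h, h1, h2⟩
      refine ⟨⟨η, hη⟩, fun B hB => ?_, rfl⟩
      have hmem : η ∈ c.tauClosure (EllisGroup.map '' B) :=
        ⟨hη, F, hF, h.mono fun z hz => Set.image_mono (Set.sInter_subset_of_mem hB) hz, h1, h2⟩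
      rw [show c.tauClosure (EllisGroup.map '' B) = EllisGroup.map '' B from hA hB] at hmem
      obtain ⟨θ, hθ, rfl⟩ := hmem
      exact hθ)
    (by
      intro A hA B hB
      refine Set.Subset.antisymm ?_ (c.subset_tauClosure (c.image_map_subset _))
      rintro η ⟨hη, F, hF, h, h1, h2⟩
      rw [Set.image_union]
      by_cases hcase : ∃ᶠ z in F, z.2 ∈ EllisGroup.map '' A
      · left
        have hmem : η ∈ c.tauClosure (EllisGroup.map '' A) :=
          ⟨hη, F ⊓ 𝓟 {z | z.2 ∈ EllisGroup.map '' A},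
            frequently_mem_iff_neBot.1 hcase, mem_inf_of_right (mem_principal_self _),
            h1.mono_left inf_le_left, h2.mono_left inf_le_left⟩
        rwa [show c.tauClosure (EllisGroup.map '' A) = EllisGroup.map '' A from hA] at hmem
      · right
        have hmem : η ∈ c.tauClosure (EllisGroup.map '' B) := by
          refine ⟨hη, F, hF, ?_, h1, h2⟩
          filter_upwards [h, not_frequently.1 hcase] with z hz hz'
          rw [Set.image_union] at hz
          exact hz.resolve_left hz'
        rwa [show c.tauClosure (EllisGroup.map '' B) = EllisGroup.map '' B from hB] at hmem)

end MinimalIdempotent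

end EllisGroup

end TopDyn

/-! ## Saturated and strongly homogeneous models, automorphism groups -/

namespace FirstOrder.Language

section Models

variable (L : Language.{u, v})

/-- `M` is `κ`-saturated: every complete type in finitely many variables over a subset of `M` of
cardinality less than `κ` is realized in `M`. -/
def IsSaturated (κ : Cardinal.{w'}) (M : Type w') [L.Structure M] [Nonempty M] : Prop :=
  ∀ A : Set M, #A < κ → ∀ (n : ℕ) (p : (L[[A]].completeTheory M).CompleteType (Fin n)),
    p ∈ (L[[A]].completeTheory M).realizedTypes M (Fin n)

/-- `M` is strongly `κ`-homogeneous: every partial elementary map between subsets of `M` of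
cardinality less than `κ` extends to an automorphism of `M`. -/
def IsStronglyHomogeneous (κ : Cardinal.{w'}) (M : Type w') [L.Structure M] : Prop :=
  ∀ A : Set M, #A < κ → ∀ f : A → M,
    (∀ φ : L.Formula A, φ.Realize (fun a : A => (a : M)) ↔ φ.Realize f) →
    ∃ σ : M ≃[L] M, ∀ a : A, σ a = f a

variable {L}

/-- The group `Aut(M)` of automorphisms of a structure, under composition. -/
instance autGroup {M : Type w'} [L.Structure M] : Group (M ≃[L] M) where
  mul f g := f.comp g
  one := Equiv.refl L M
  inv f := f.symm
  mul_assoc _ _ _ := rfl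
  one_mul _ := Equiv.refl_comp _
  mul_one _ := Equiv.comp_refl _
  inv_mul_cancel f := Equiv.ext fun x => f.symm_apply_apply x

end Models

/-! ## Spaces of complete types over a model -/

section Types

variable {L : Language.{u, v}} (M : Type w') [L.Structure M] {I : Type w}

/-- Complete types over (all elements of) the model `M`, in variables indexed by `I`. -/
abbrev TypeOver (L : Language.{u, v}) (M : Type w') [L.Structure M] (I : Type w) :=
  (L.elementaryDiagram M).CompleteType I

variable {M}

/-- The formula `φ(x, b)` with parameters from `M`, for `φ(x, y)` without parameters. -/
def instFormula {m : ℕ} (φ : L.Formula (I ⊕ Fin m)) (b : Fin m → M) : L[[M]].Formula I :=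
  BoundedFormula.subst ((L.lhomWithConstants M).onFormula φ)
    (Sum.elim Term.var fun j => (L.con (b j)).term)

/-- `φ(x, a) ∈ p`, for a formula with parameters from `M`. -/
def TypeOver.Has (p : TypeOver L M I) (ψ : L[[M]].Formula I) : Prop :=
  Formula.equivSentence ψ ∈ p

/-- The renaming of constants that replaces the constant `a` from `M` with `σ a`. -/
def moveConstants (σ : M → M) : L[[M]] →ᴸ L[[M]] :=
  L.lhomWithConstantsMap σ

theorem moveConstants_id : moveConstants (L := L) (id : M → M) = LHom.id _ := by
  refine LHom.funext ?_ ?_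
  · funext n f
    rcases f with f | f
    · rfl
    · cases n
      · rfl
      · exact isEmptyElim f
  · funext n R
    rcases R with R | R
    · rfl
    · exact isEmptyElim R

theorem moveConstants_comp (σ τ : M → M) :
    moveConstants (L := L) (σ ∘ τ) = (moveConstants σ).comp (moveConstants τ) := by
  refine LHom.funext ?_ ?_
  · funext n f
    rcases f with f | f
    · rfl
    · cases n
      · rfl
      · exact isEmptyElim f
  · funext n R
    rcases R with R | R
    · rfl
    · exact isEmptyElim R

theorem moveConstants_comp_lhom (σ : M → M) :
    (moveConstants (L := L) σ).comp (L.lhomWithConstants M) = L.lhomWithConstants M :=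
  LHom.map_constants_comp_sumInl L

theorem realize_onSentence_of_equiv {L₁ : Language.{u, v}} {L₂ : Language.{w, w''}} (F : L₁ →ᴸ L₂)
    {N N' : Type w'} [L₁.Structure N] [L₂.Structure N'] (e : N ≃ N')
    (hf : ∀ (n : ℕ) (f : L₁.Functions n) (x : Fin n → N),
      e (Structure.funMap f x) = Structure.funMap (F.onFunction f) (e ∘ x))
    (hR : ∀ (n : ℕ) (R : L₁.Relations n) (x : Fin n → N),
      Structure.RelMap (F.onRelation R) (e ∘ x) ↔ Structure.RelMap R x)
    (ψ : L₁.Sentence) : N' ⊨ F.onSentence ψ ↔ N ⊨ ψ := by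
  let _ : L₁.Structure N' := F.reduct N'
  let g : N ≃[L₁] N' := ⟨e, fun f x => hf _ f x, fun R x => hR _ R x⟩
  exact (F.realize_onSentence N' ψ).trans (StrongHomClass.realize_sentence g ψ).symm

/-- Automorphisms move true sentences with parameters to true sentences. -/
theorem realize_moveConstants (σ : M ≃[L] M) (ψ : L[[M]].Sentence) :
    M ⊨ (moveConstants σ).onSentence ψ ↔ M ⊨ ψ := by
  refine realize_onSentence_of_equiv (moveConstants σ) σ.toEquiv ?_ ?_ ψ
  · intro n f x
    rcases f with f | f
    · exact σ.map_fun f x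
    · cases n
      · rfl
      · exact isEmptyElim f
  · intro n R x
    rcases R with R | R
    · exact σ.map_rel R x
    · exact isEmptyElim R

theorem onTerm_varsToConstants {L₁ L₂ : Language.{u, v}} {γ : Type w} {α : Type w'}
    (F : L₁ →ᴸ L₂) (t : L₁.Term (γ ⊕ α)) :
    (F.addConstants γ).onTerm t.varsToConstants = (F.onTerm t).varsToConstants := by
  induction t with
  | var x =>
    rcases x with x | x
    · exact congrArg (Term.func _) (Subsingleton.elim _ _)
    · rfl
  | func f ts ih =>
    simp only [Term.varsToConstants, LHom.onTerm, ih]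
    rfl

theorem onTerm_relabel {L₁ L₂ : Language.{u, v}} {α : Type w} {β : Type w'}
    (F : L₁ →ᴸ L₂) (g : α → β) (t : L₁.Term α) :
    F.onTerm (t.relabel g) = (F.onTerm t).relabel g := by
  induction t with
  | var x => rfl
  | func f ts ih => simp only [Term.relabel, LHom.onTerm, ih]

theorem onTerm_aux {L₁ L₂ : Language.{u, v}} (F : L₁ →ᴸ L₂) {n : ℕ} (t : L₁.Term (I ⊕ Fin n)) :
    (F.addConstants I).onTerm (Term.constantsVarsEquivLeft.symm ((Term.relabelEquiv
        ((_root_.Equiv.sumEmpty I Empty).sumCongr (_root_.Equiv.refl _))).symm t)) =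
      Term.constantsVarsEquivLeft.symm ((Term.relabelEquiv
        ((_root_.Equiv.sumEmpty I Empty).sumCongr (_root_.Equiv.refl _))).symm (F.onTerm t)) := by
  simp only [Term.relabelEquiv_symm_apply, Term.constantsVarsEquivLeft_symm_apply,
    onTerm_varsToConstants, onTerm_relabel]

theorem onBoundedFormula_aux {L₁ L₂ : Language.{u, v}}
    (F : L₁ →ᴸ L₂) {n : ℕ} (ψ : L₁.BoundedFormula I n) :
    (F.addConstants I).onBoundedFormula (BoundedFormula.constantsVarsEquiv.symm
        ((BoundedFormula.relabelEquiv (_root_.Equiv.sumEmpty I Empty)).symm ψ)) =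
      BoundedFormula.constantsVarsEquiv.symm
        ((BoundedFormula.relabelEquiv (_root_.Equiv.sumEmpty I Empty)).symm
          (F.onBoundedFormula ψ)) := by
  induction ψ with
  | falsum => rfl
  | equal t₁ t₂ => exact congrArg₂ BoundedFormula.equal (onTerm_aux F t₁) (onTerm_aux F t₂)
  | rel R ts => exact congrArg (BoundedFormula.rel _) (funext fun i => onTerm_aux F (ts i))
  | imp _ _ ih1 ih2 => exact congrArg₂ BoundedFormula.imp ih1 ih2
  | all _ ih => exact congrArg BoundedFormula.all ih

/-- Renaming symbols commutes with viewing formulas as sentences with new constants. -/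
theorem onSentence_equivSentence {L₁ L₂ : Language.{u, v}} (F : L₁ →ᴸ L₂)
    (ψ : L₁.Formula I) :
    (F.addConstants I).onSentence (Formula.equivSentence ψ) =
      Formula.equivSentence (F.onFormula ψ) :=
  onBoundedFormula_aux F ψ

theorem addConstants_comp {L₁ L₂ L₃ : Language} (F : L₂ →ᴸ L₃) (F' : L₁ →ᴸ L₂) :
    (F.comp F').addConstants I = (F.addConstants I).comp (F'.addConstants I) := by
  refine LHom.funext ?_ ?_
  · funext n f
    rcases f with f | f <;> rfl
  · funext n R
    rcases R with R | R <;> rfl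

theorem addConstants_id {L₁ : Language} : (LHom.id L₁).addConstants I = LHom.id L₁[[I]] := by
  refine LHom.funext ?_ ?_
  · funext n f
    rcases f with f | f <;> rfl
  · funext n R
    rcases R with R | R <;> rfl

/-- The image of a sentence with constants from `M` and `I` under a permutation `σ` of `M`. -/
def moveSentence (I : Type w) (σ : M → M) (ψ : L[[M]][[I]].Sentence) : L[[M]][[I]].Sentence :=
  ((moveConstants σ).addConstants I).onSentence ψ

theorem moveSentence_id (ψ : L[[M]][[I]].Sentence) : moveSentence I id ψ = ψ := by
  unfold moveSentence
  rw [moveConstants_id, addConstants_id]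
  exact congrFun LHom.id_onBoundedFormula ψ

theorem moveSentence_comp (σ τ : M → M) (ψ : L[[M]][[I]].Sentence) :
    moveSentence I (σ ∘ τ) ψ = moveSentence I σ (moveSentence I τ ψ) := by
  unfold moveSentence
  rw [moveConstants_comp, addConstants_comp]
  exact congrFun (LHom.comp_onBoundedFormula _ _) ψ

theorem moveSentence_symm (σ : M ≃[L] M) (ψ : L[[M]][[I]].Sentence) :
    moveSentence I σ (moveSentence I σ.symm ψ) = ψ := by
  rw [← moveSentence_comp, show (σ : M → M) ∘ σ.symm = id from funext σ.apply_symm_apply,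
    moveSentence_id]

theorem moveConstants_symm (σ : M ≃[L] M) :
    (moveConstants (L := L) σ.symm).comp (moveConstants σ) = LHom.id _ := by
  rw [← moveConstants_comp, show (σ.symm : M → M) ∘ σ = id from funext σ.symm_apply_apply,
    moveConstants_id]

theorem addConstants_moveConstants_injective (σ : M ≃[L] M) :
    ((moveConstants (L := L) σ).addConstants I).Injective := by
  have h : ((moveConstants (L := L) σ.symm).addConstants I).comp
      ((moveConstants (L := L) σ).addConstants I) = LHom.id _ := by
    rw [← addConstants_comp, moveConstants_symm, addConstants_id]
  constructor
  · intro n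
    refine Function.LeftInverse.injective
      (g := fun f => ((moveConstants (L := L) σ.symm).addConstants I).onFunction f) fun f => ?_
    exact congrArg (fun F : L[[M]][[I]] →ᴸ L[[M]][[I]] => F.onFunction f) h
  · intro n
    refine Function.LeftInverse.injective
      (g := fun R => ((moveConstants (L := L) σ.symm).addConstants I).onRelation R) fun R => ?_
    exact congrArg (fun F : L[[M]][[I]] →ᴸ L[[M]][[I]] => F.onRelation R) h

theorem moveSentence_lhomWithConstants (σ : M → M) (ψ : L[[M]].Sentence) :
    moveSentence I σ ((L[[M]].lhomWithConstants I).onSentence ψ) =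
      (L[[M]].lhomWithConstants I).onSentence ((moveConstants σ).onSentence ψ) := by
  have h : ((moveConstants (L := L) σ).addConstants I).comp (L[[M]].lhomWithConstants I) =
      (L[[M]].lhomWithConstants I).comp (moveConstants σ) := rfl
  have h1 := congrFun (LHom.comp_onBoundedFormula (α := Empty) (n := 0)
    ((moveConstants (L := L) σ).addConstants I) (L[[M]].lhomWithConstants I)) ψ
  have h2 := congrFun (LHom.comp_onBoundedFormula (α := Empty) (n := 0)
    (L[[M]].lhomWithConstants I) (moveConstants (L := L) σ)) ψ
  rw [h] at h1
  exact h1.symm.trans h2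

theorem onSentence_moveConstants_symm (σ : M ≃[L] M) (ψ : L[[M]].Sentence) :
    (moveConstants σ).onSentence ((moveConstants σ.symm).onSentence ψ) = ψ := by
  have h := congrFun (LHom.comp_onBoundedFormula (α := Empty) (n := 0)
    (moveConstants (L := L) σ) (moveConstants (L := L) σ.symm)) ψ
  rw [← moveConstants_comp, show (σ : M → M) ∘ σ.symm = id from funext σ.apply_symm_apply,
    moveConstants_id, LHom.id_onBoundedFormula] at h
  exact h.symm

/-- The image `σ(p) = {φ(x, σ(a)) : φ(x, a) ∈ p}` of a complete type over `M`. -/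
def TypeOver.move (σ : M ≃[L] M) (p : TypeOver L M I) : TypeOver L M I where
  toTheory := moveSentence I σ '' p.toTheory
  subset' := by
    rintro _ ⟨ψ, hψ, rfl⟩
    refine ⟨(L[[M]].lhomWithConstants I).onSentence ((moveConstants σ.symm).onSentence ψ),
      p.subset' ⟨_, (realize_moveConstants σ.symm ψ).2 hψ, rfl⟩, ?_⟩
    rw [moveSentence_lhomWithConstants, onSentence_moveConstants_symm]
  isMaximal' := by
    constructor
    · exact (Theory.isSatisfiable_onTheory_iff (addConstants_moveConstants_injective σ)).2
        p.isMaximal.1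
    · intro ψ
      rcases p.mem_or_not_mem (moveSentence I σ.symm ψ) with h | h
      · exact Or.inl ⟨_, h, moveSentence_symm σ ψ⟩
      · exact Or.inr ⟨_, h, congrArg BoundedFormula.not (moveSentence_symm σ ψ)⟩

/-- The group `Aut(M)` acts on the complete types over `M` by `σ(p) = {φ(x, σ(a)) : φ(x, a) ∈ p}`. -/
instance : MulAction (M ≃[L] M) (TypeOver L M I) where
  smul := TypeOver.move
  one_smul p := by
    refine SetLike.coe_injective ?_
    change moveSentence I id '' p.toTheory = p.toTheory
    simp [moveSentence_id]
  mul_smul σ τ p := by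
    refine SetLike.coe_injective ?_
    change moveSentence I ((σ : M → M) ∘ τ) '' p.toTheory =
      moveSentence I σ '' (moveSentence I τ '' p.toTheory)
    rw [Set.image_image]
    exact Set.image_congr fun ψ _ => moveSentence_comp σ τ ψ

/-- The space `S_π(M)` of complete types over `M` that contain the partial type `π(x)`, a set of
formulas without parameters; it is also written `S_X(M)`, where `X` is the set defined by `π`. -/
def TypeSpace (M : Type w') [L.Structure M] (π : Set (L.Formula I)) : Type _ :=
  {p : TypeOver L M I // ∀ φ ∈ π, p.Has ((L.lhomWithConstants M).onFormula φ)}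

variable {π : Set (L.Formula I)}

instance : TopologicalSpace (TypeSpace M π) :=
  instTopologicalSpaceSubtype

theorem TypeOver.has_lhom_smul (σ : M ≃[L] M) (p : TypeOver L M I) (φ : L.Formula I)
    (h : p.Has ((L.lhomWithConstants M).onFormula φ)) :
    (σ • p).Has ((L.lhomWithConstants M).onFormula φ) := by
  refine ⟨_, h, ?_⟩
  unfold moveSentence
  rw [onSentence_equivSentence]
  have h1 := congrFun (LHom.comp_onBoundedFormula (α := I) (n := 0)
    (moveConstants (L := L) σ) (L.lhomWithConstants M)) φ
  rw [moveConstants_comp_lhom] at h1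
  exact congrArg Formula.equivSentence h1.symm

/-- The action of `Aut(M)` on `S_π(M)`. -/
instance : MulAction (M ≃[L] M) (TypeSpace M π) where
  smul σ p := ⟨σ • p.1, fun φ hφ => p.1.has_lhom_smul σ φ (p.2 φ hφ)⟩
  one_smul p := Subtype.ext (one_smul _ p.1)
  mul_smul σ τ p := Subtype.ext (mul_smul σ τ p.1)

/-- `φ(x, b) ∈ p`, for `φ(x, y)` without parameters and a finite tuple `b` in `M`. -/
def TypeSpace.Has {m : ℕ} (p : TypeSpace M π) (φ : L.Formula (I ⊕ Fin m)) (b : Fin m → M) : Prop :=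
  p.1.Has (instFormula φ b)

end Types

/-! ## Infinitary definability patterns -/

section Patterns

variable {L : Language.{u, v}} (T : L.Theory) {I : Type w}

/-- The content `c(p₁, …, pₙ)`: the set of all `(φ₁(x, y), …, φₙ(x, y), q(y))`, with `y` a finite
tuple of variables and `q` a complete type over `∅`, such that for some `b` realizing `q` one has
`φᵢ(x, b) ∈ pᵢ` for all `i`. -/
def content {M : Type w'} [L.Structure M] [Nonempty M] [M ⊨ T] {π : Set (L.Formula I)} {n : ℕ}
    (p : Fin n → TypeSpace M π) :
    Set (Σ m : ℕ, (Fin n → L.Formula (I ⊕ Fin m)) × T.CompleteType (Fin m)) :=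
  {z | ∃ b : Fin z.1 → M, T.typeOf b = z.2.2 ∧ ∀ i, (p i).Has (z.2.1 i) b}

/-- The (relational) language of infinitary definability patterns: an `n`-ary relation symbol
`R_{φ,q}` for all `φ = (φ₁(x, y), …, φₙ(x, y))` and `q(y)` as above. -/
def ipLanguage (I : Type w) : Language where
  Functions _ := Empty
  Relations n := Σ m : ℕ, (Fin n → L.Formula (I ⊕ Fin m)) × T.CompleteType (Fin m)

variable {M : Type w'} [L.Structure M] [Nonempty M] [M ⊨ T] {π : Set (L.Formula I)}

/-- The infinitary definability patterns structure on `S_π(M)`: `R_{φ,q}(p₁, …, pₙ)` holds iff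
`(φ₁, …, φₙ, q) ∉ c(p₁, …, pₙ)`. -/
instance : (ipLanguage T I).Structure (TypeSpace M π) where
  funMap f := f.elim
  RelMap z p := z ∉ content T p

/-- Every subset of `S_π(M)` is a substructure for infinitary definability patterns. -/
def ipSubstructure (J : Set (TypeSpace M π)) : (ipLanguage T I).Substructure (TypeSpace M π) where
  carrier := J
  fun_mem f := f.elim

variable {T}

/-- The subbasic closed set `F_{φ,p,q,r}` of automorphisms `f` of `J` for which
`R_{φ,r}(f(p₁), …, f(pₘ), q₁, …, qₙ)` holds. -/
def ippClosed {J : (ipLanguage T I).Substructure (TypeSpace M π)} {m n : ℕ}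
    (R : (ipLanguage T I).Relations (m + n)) (p : Fin m → J) (q : Fin n → J) :
    Set (J ≃[ipLanguage T I] J) :=
  {f | Structure.RelMap R (Fin.append (fun i => f (p i)) q)}

/-- The ipp-topology on `Aut(J)`, with the sets `F_{φ,p,q,r}` as a subbasis of closed sets. -/
instance {J : (ipLanguage T I).Substructure (TypeSpace M π)} :
    TopologicalSpace (J ≃[ipLanguage T I] J) :=
  TopologicalSpace.generateFrom
    {U | ∃ (m n : ℕ) (R : (ipLanguage T I).Relations (m + n)) (p : Fin m → J) (q : Fin n → J),
      U = (ippClosed R p q)ᶜ}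

variable (T)

/-- The core `J̄ = Im(u)`, as an infinitary definability patterns structure. -/
def core (c : TopDyn.MinimalIdempotent (M ≃[L] M) (TypeSpace M π)) :
    (ipLanguage T I).Substructure (TypeSpace M π) :=
  ipSubstructure T (Set.range c.u)

end Patterns

end FirstOrder.Language

/-! Everything reduces to maps between type spaces that do not enlarge contents of finite tuples
(`IsPatternHom`). This notion makes no reference to automorphisms and also makes sense between the
type spaces of two different models.

Over a strongly ℵ₀-homogeneous model the pattern endomorphisms are exactly the elements of the Ellis
semigroup (`isPatternHom_of_mem_ellisSemigroup`, `mem_ellisSemigroup_of_isPatternHom`): a basic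
neighbourhood involves one finite parameter tuple, and homogeneity moves any tuple of the same type
onto it. Saturation gives pattern homomorphisms f and g between the two type spaces, in both
directions, by pulling types back along maps that are elementary on larger and larger finite sets
(`exists_isPatternHom`). After absorbing u and v, the composite gf lies in the group uℳ, so g can be
corrected by an inverse to get gf = u. Then fg is an idempotent of the group v𝒩, hence fg = v, and
f, g restrict to inverse isomorphisms of the cores (`nonempty_coreEquiv`).

The same dictionary identifies uℳ with the automorphism group of Im(u): elements of uℳ restrict, and
an automorphism precomposed with u is a pattern endomorphism. Both topologies compare the finite
data of pairs (σ, σb), so τ-closed and ipp-closed sets correspond. The last claim follows by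
conjugating with an isomorphism of cores. -/

namespace FirstOrder.Language

/-! ### Renaming symbols and parameters in formulas -/

section Renaming

variable {L : Language.{u, v}} {I : Type w} {M : Type w'} {N : Type w''}

/-- The two languages may lie in different universes here, as needed for `L[[N]]` and `L[[M]]` with
unrelated models. -/
theorem LHom.onTerm_varsToConstants {L₁ L₂ : Language} {γ α : Type*}
    (F : L₁ →ᴸ L₂) (t : L₁.Term (γ ⊕ α)) :
    (F.addConstants γ).onTerm t.varsToConstants = (F.onTerm t).varsToConstants := by
  induction t with
  | var x =>
    rcases x with x | x
    · exact congrArg (Term.func _) (Subsingleton.elim _ _)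
    · rfl
  | func f ts ih =>
    simp only [Term.varsToConstants, LHom.onTerm, ih]
    rfl

theorem LHom.onTerm_relabel {L₁ L₂ : Language} {α β : Type*}
    (F : L₁ →ᴸ L₂) (g : α → β) (t : L₁.Term α) :
    F.onTerm (t.relabel g) = (F.onTerm t).relabel g := by
  induction t with
  | var x => rfl
  | func f ts ih => simp only [Term.relabel, LHom.onTerm, ih]

/-- Renaming symbols commutes with viewing formulas as sentences with new constants. -/
theorem LHom.onSentence_equivSentence {L₁ L₂ : Language} (F : L₁ →ᴸ L₂)
    (ψ : L₁.Formula I) :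
    (F.addConstants I).onSentence (Formula.equivSentence ψ) =
      Formula.equivSentence (F.onFormula ψ) := by
  have hterm : ∀ {n : ℕ} (t : L₁.Term (I ⊕ Fin n)),
      (F.addConstants I).onTerm (Term.constantsVarsEquivLeft.symm ((Term.relabelEquiv
        ((_root_.Equiv.sumEmpty I Empty).sumCongr (_root_.Equiv.refl _))).symm t)) =
      Term.constantsVarsEquivLeft.symm ((Term.relabelEquiv
        ((_root_.Equiv.sumEmpty I Empty).sumCongr (_root_.Equiv.refl _))).symm (F.onTerm t)) := by
    intro n t
    simp only [Term.relabelEquiv_symm_apply, Term.constantsVarsEquivLeft_symm_apply,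
      LHom.onTerm_varsToConstants, LHom.onTerm_relabel]
  have main : ∀ {n : ℕ} (ψ : L₁.BoundedFormula I n),
      (F.addConstants I).onBoundedFormula (BoundedFormula.constantsVarsEquiv.symm
        ((BoundedFormula.relabelEquiv (_root_.Equiv.sumEmpty I Empty)).symm ψ)) =
      BoundedFormula.constantsVarsEquiv.symm
        ((BoundedFormula.relabelEquiv (_root_.Equiv.sumEmpty I Empty)).symm
          (F.onBoundedFormula ψ)) := by
    intro n ψ
    induction ψ with
    | falsum => rfl
    | equal t₁ t₂ => exact congrArg₂ BoundedFormula.equal (hterm t₁) (hterm t₂)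
    | rel R ts => exact congrArg (BoundedFormula.rel _) (funext fun i => hterm (ts i))
    | imp _ _ ih1 ih2 => exact congrArg₂ BoundedFormula.imp ih1 ih2
    | all _ ih => exact congrArg BoundedFormula.all ih
  exact main ψ

theorem LHom.onTerm_subst {L₁ L₂ : Language} {α β : Type*} (F : L₁ →ᴸ L₂)
    (g : α → L₁.Term β) (t : L₁.Term α) :
    F.onTerm (t.subst g) = (F.onTerm t).subst (fun a => F.onTerm (g a)) := by
  induction t with
  | var x => rfl
  | func f ts ih => simp only [Term.subst, LHom.onTerm, ih]

theorem LHom.onBoundedFormula_subst {L₁ L₂ : Language} {α β : Type*} (F : L₁ →ᴸ L₂)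
    (g : α → L₁.Term β) {n : ℕ} (φ : L₁.BoundedFormula α n) :
    F.onBoundedFormula (φ.subst g) = (F.onBoundedFormula φ).subst (fun a => F.onTerm (g a)) := by
  have hterm : ∀ {n : ℕ} (t : L₁.Term (α ⊕ Fin n)),
      F.onTerm (t.subst (Sum.elim (Term.relabel Sum.inl ∘ g) (Term.var ∘ Sum.inr))) =
      (F.onTerm t).subst
        (Sum.elim (Term.relabel Sum.inl ∘ fun a => F.onTerm (g a)) (Term.var ∘ Sum.inr)) := by
    intro n t
    rw [LHom.onTerm_subst]
    congr 1
    funext a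
    rcases a with a | a
    · exact LHom.onTerm_relabel F _ _
    · rfl
  induction φ with
  | falsum => rfl
  | equal t₁ t₂ => exact congrArg₂ BoundedFormula.equal (hterm t₁) (hterm t₂)
  | rel R ts => exact congrArg (BoundedFormula.rel _) (funext fun i => hterm (ts i))
  | imp _ _ ih1 ih2 => exact congrArg₂ BoundedFormula.imp ih1 ih2
  | all _ ih => exact congrArg BoundedFormula.all ih

theorem onFormula_instFormula (s : N → M) {m : ℕ} (φ : L.Formula (I ⊕ Fin m)) (b : Fin m → N) :
    (L.lhomWithConstantsMap s).onFormula (instFormula φ b) = instFormula φ (s ∘ b) := by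
  have h1 := congrFun (LHom.comp_onBoundedFormula (α := I ⊕ Fin m) (n := 0)
    (L.lhomWithConstantsMap s) (L.lhomWithConstants N)) φ
  have h2 : (L.lhomWithConstantsMap s).comp (L.lhomWithConstants N) = L.lhomWithConstants M :=
    LHom.map_constants_comp_sumInl L
  rw [h2] at h1
  refine (LHom.onBoundedFormula_subst _ _ _).trans ?_
  refine congrArg₂ (fun (χ : L[[M]].BoundedFormula (I ⊕ Fin m) 0) g => χ.subst g) h1.symm ?_
  funext a
  rcases a with a | a
  · rfl
  · exact congrArg (Term.func _) (Subsingleton.elim _ _)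

theorem onSentence_lhomWithConstants (s : N → M) (ψ : L[[N]].Sentence) :
    ((L.lhomWithConstantsMap s).addConstants I).onSentence
        ((L[[N]].lhomWithConstants I).onSentence ψ) =
      (L[[M]].lhomWithConstants I).onSentence ((L.lhomWithConstantsMap s).onSentence ψ) := by
  have h : ((L.lhomWithConstantsMap s).addConstants I).comp (L[[N]].lhomWithConstants I) =
      (L[[M]].lhomWithConstants I).comp (L.lhomWithConstantsMap s) := rfl
  have h1 := congrFun (LHom.comp_onBoundedFormula (α := Empty) (n := 0)
    ((L.lhomWithConstantsMap s).addConstants I) (L[[N]].lhomWithConstants I)) ψ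
  have h2 := congrFun (LHom.comp_onBoundedFormula (α := Empty) (n := 0)
    (L[[M]].lhomWithConstants I) (L.lhomWithConstantsMap s)) ψ
  rw [h] at h1
  exact h1.symm.trans h2

theorem Formula.realize_congr_of_freeVarFinset {α : Type*} [DecidableEq α] {K : Type*}
    [L.Structure K] (θ : L.Formula α) {x y : α → K} (h : ∀ a ∈ θ.freeVarFinset, x a = y a) :
    θ.Realize x ↔ θ.Realize y :=
  (BoundedFormula.realize_restrictFreeVar (φ := θ) (f := id) (v := fun a => x a) x
    fun _ => rfl).symm.trans
    (BoundedFormula.realize_restrictFreeVar (φ := θ) (f := id) (v := fun a => x a) y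
      fun a => h a a.2)

end Renaming

/-! ### Types over a model and formulas with finite parameter tuples -/

section Types

variable {L : Language.{u, v}} {I : Type w} {M : Type w'} [L.Structure M]

/-- Turns membership in a type into satisfaction, so that rewritings of formulas can be checked
semantically. -/
theorem TypeOver.exists_realization (p : TypeOver L M I) :
    ∃ (K : Theory.ModelType.{max u w', v, max u v w w'} (L.elementaryDiagram M)) (x : I → K),
      ∀ ψ : L[[M]].Formula I, p.Has ψ ↔ ψ.Realize x := by
  obtain ⟨K, x, rfl⟩ := Theory.exists_modelType_is_realized_in (L.elementaryDiagram M) p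
  exact ⟨K, x, fun ψ => Theory.CompleteType.formula_mem_typeOf⟩

theorem realize_instFormula {K : Type*} [L.Structure K] [L[[M]].Structure K]
    [(L.lhomWithConstants M).IsExpansionOn K] {m : ℕ} (φ : L.Formula (I ⊕ Fin m)) (b : Fin m → M)
    (x : I → K) :
    (instFormula φ b).Realize x ↔ φ.Realize (Sum.elim x fun j => (L.con (b j) : K)) := by
  refine BoundedFormula.realize_subst.trans ?_
  refine (LHom.realize_onFormula (L.lhomWithConstants M) φ).trans ?_
  refine iff_of_eq (congrArg φ.Realize ?_)
  funext a
  rcases a with a | a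
  · rfl
  · exact Term.realize_constants

/-- Finitely many formulas with parameters can be written with a common finite tuple of
parameters. -/
theorem TypeOver.exists_instFormula [Nonempty M] {n : ℕ} (ψ : Fin n → L[[M]].Formula I) :
    ∃ (m : ℕ) (b : Fin m → M) (φ : Fin n → L.Formula (I ⊕ Fin m)),
      ∀ i (p : TypeOver L M I), p.Has (ψ i) ↔ p.Has (instFormula (φ i) b) := by
  classical
  obtain ⟨a₀⟩ := ‹Nonempty M›
  let θ : Fin n → L.Formula (M ⊕ I) := fun i => BoundedFormula.constantsVarsEquiv (ψ i)
  -- Including `a₀` makes `S` nonempty, so that `g` has a default index for parameters outside `S`.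
  let S : Finset M := insert a₀ (Finset.univ.biUnion fun i => (θ i).freeVarFinset.toLeft)
  let e := S.equivFin
  let g : M ⊕ I → I ⊕ Fin S.card := Sum.elim
    (fun a => Sum.inr (if h : a ∈ S then e ⟨a, h⟩ else e ⟨a₀, Finset.mem_insert_self _ _⟩)) Sum.inl
  refine ⟨S.card, fun j => e.symm j, fun i => (θ i).relabel g, fun i p => ?_⟩
  obtain ⟨K, x, hK⟩ := p.exists_realization
  let _ : L.Structure K := (L.lhomWithConstants M).reduct K
  have : (L.lhomWithConstants M).IsExpansionOn K := LHom.isExpansionOn_reduct _ _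
  rw [hK, hK, realize_instFormula, Formula.realize_relabel]
  refine (BoundedFormula.realize_constantsVarsEquiv (φ := ψ i)).symm.trans ?_
  refine Formula.realize_congr_of_freeVarFinset (θ i) fun a ha => ?_
  rcases a with a | a
  · have haS : a ∈ S := Finset.mem_insert_of_mem
      (Finset.mem_biUnion.2 ⟨i, Finset.mem_univ _, Finset.mem_toLeft.2 ha⟩)
    simp [g, haS]
  · rfl

/-- Used to pad a pattern at the coordinates where no condition is wanted. -/
theorem TypeOver.has_top (p : TypeOver L M I) {m : ℕ} (b : Fin m → M) :
    p.Has (instFormula ⊤ b) := by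
  obtain ⟨K, x, hK⟩ := p.exists_realization
  let _ : L.Structure K := (L.lhomWithConstants M).reduct K
  have : (L.lhomWithConstants M).IsExpansionOn K := LHom.isExpansionOn_reduct _ _
  rw [hK, realize_instFormula]
  exact BoundedFormula.realize_top.2 trivial

theorem TypeOver.smul_has_instFormula (σ : M ≃[L] M) (p : TypeOver L M I) {m : ℕ}
    (φ : L.Formula (I ⊕ Fin m)) (b : Fin m → M) :
    (σ • p).Has (instFormula φ (σ ∘ b)) ↔ p.Has (instFormula φ b) := by
  have key : ∀ (σ : M ≃[L] M) (p : TypeOver L M I) (b : Fin m → M),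
      p.Has (instFormula φ b) → (σ • p).Has (instFormula φ (σ ∘ b)) := by
    intro σ p b h
    refine ⟨_, h, ?_⟩
    refine (LHom.onSentence_equivSentence (L.lhomWithConstantsMap σ) (instFormula φ b)).trans ?_
    rw [onFormula_instFormula]
  refine ⟨fun h => ?_, key σ p b⟩
  have h' := key σ⁻¹ _ _ h
  rw [inv_smul_smul] at h'
  rwa [show (σ⁻¹ : M ≃[L] M) ∘ σ ∘ b = b from funext fun j => σ.symm_apply_apply (b j)] at h'

end Types

/-! ### Ultralimits of pulled-back types -/

section Ultralimit

variable {L : Language.{u, v}} {I : Type w} {M : Type w'} [L.Structure M] {N : Type w''}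
  [L.Structure N] {ι : Type*}

/-- The limit along an ultrafilter of the pullbacks of a complete type over `M` under maps
`s i : N → M`, where each elementary property of `N` is preserved by almost all `s i`. -/
def TypeOver.ultralimit (U : Ultrafilter ι) (s : ι → N → M)
    (hs : ∀ ψ ∈ L.elementaryDiagram N,
      ∀ᶠ i in U, (L.lhomWithConstantsMap (s i)).onSentence ψ ∈ L.elementaryDiagram M)
    (p : TypeOver L M I) : TypeOver L N I where
  toTheory := {ψ | ∀ᶠ i in U, ((L.lhomWithConstantsMap (s i)).addConstants I).onSentence ψ ∈ p}
  subset' := by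
    rintro _ ⟨ψ, hψ, rfl⟩
    filter_upwards [hs ψ hψ] with i hi
    rw [onSentence_lhomWithConstants]
    exact p.subset ⟨_, hi, rfl⟩
  isMaximal' := by
    refine ⟨Theory.isSatisfiable_iff_isFinitelySatisfiable.2 fun T₀ hT₀ => ?_, fun ψ => ?_⟩
    · have h : ∀ᶠ i in U, ∀ ψ ∈ T₀,
          ((L.lhomWithConstantsMap (s i)).addConstants I).onSentence ψ ∈ p :=
        (Filter.eventually_all_finset T₀).2 fun ψ hψ => hT₀ hψ
      obtain ⟨i, hi⟩ := h.exists
      refine Theory.isSatisfiable_of_isSatisfiable_onTheory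
        ((L.lhomWithConstantsMap (s i)).addConstants I) (p.isMaximal.1.mono ?_)
      rintro _ ⟨ψ, hψ, rfl⟩
      exact hi ψ hψ
    · by_cases h : ∀ᶠ i in U, ((L.lhomWithConstantsMap (s i)).addConstants I).onSentence ψ ∈ p
      · exact Or.inl h
      · refine Or.inr ?_
        filter_upwards [Ultrafilter.eventually_not.2 h] with i hi
        exact (p.not_mem_iff _).2 hi

theorem TypeOver.ultralimit_has (U : Ultrafilter ι) (s : ι → N → M)
    (hs : ∀ ψ ∈ L.elementaryDiagram N,
      ∀ᶠ i in U, (L.lhomWithConstantsMap (s i)).onSentence ψ ∈ L.elementaryDiagram M)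
    (p : TypeOver L M I) (ψ : L[[N]].Formula I) :
    (p.ultralimit U s hs).Has ψ ↔
      ∀ᶠ i in U, p.Has ((L.lhomWithConstantsMap (s i)).onFormula ψ) := by
  refine eventually_congr (Eventually.of_forall fun i => ?_)
  exact iff_of_eq (congrArg (· ∈ p)
    (LHom.onSentence_equivSentence (L.lhomWithConstantsMap (s i)) ψ))

end Ultralimit

end FirstOrder.Language

namespace FirstOrder.Language

/-! ### Consequences of saturation and homogeneity -/

section Saturation

variable {L : Language.{u, v}} {T : L.Theory} {M : Type w'} [L.Structure M] [Nonempty M] [M ⊨ T]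
  {N : Type w''} [L.Structure N] [Nonempty N] [N ⊨ T]

theorem typeOf_eq_typeOf_iff {α : Type*} {a : α → M} {b : α → N} :
    T.typeOf a = T.typeOf b ↔ ∀ φ : L.Formula α, φ.Realize a ↔ φ.Realize b := by
  rw [SetLike.ext_iff]
  refine ⟨fun h φ => ?_, fun h φ => ?_⟩
  · rw [← Theory.CompleteType.formula_mem_typeOf (T := T), h,
      Theory.CompleteType.formula_mem_typeOf]
  · rw [Theory.CompleteType.mem_typeOf, h, Theory.CompleteType.mem_typeOf]

/-- Saturation is applied with no parameters. Completeness of `T` makes `N` a model of the theory of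
`M`, so the type of `b` is one that `M` must realize. -/
theorem IsSaturated.exists_typeOf_eq (hM : L.IsSaturated ℵ₀ M) (hT : T.IsComplete) {n : ℕ}
    (b : Fin n → N) : ∃ a : Fin n → M, T.typeOf a = T.typeOf b := by
  let _ : (constantsOn (∅ : Set M)).Structure N := constantsOn.structure isEmptyElim
  have hmodel : N ⊨ L[[(∅ : Set M)]].completeTheory M := by
    refine (Theory.model_iff _).2 fun ψ hψ => ?_
    have hψ' : M ⊨ ψ := hψ
    let θ : L.Sentence :=
      (Formula.equivSentence.symm ψ).relabel (isEmptyElim : (∅ : Set M) → Empty)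
    have hθM : M ⊨ θ := by
      refine (Formula.realize_relabel (φ := Formula.equivSentence.symm ψ)).2 ?_
      rw [Subsingleton.elim ((default : Empty → M) ∘ isEmptyElim)
        fun a : (∅ : Set M) => (L.con a : M)]
      exact (Formula.realize_equivSentence_symm_con M ψ).2 hψ'
    have hθN : N ⊨ θ := (hT.realize_sentence_iff θ N).2 ((hT.realize_sentence_iff θ M).1 hθM)
    have hθN' := (Formula.realize_relabel (φ := Formula.equivSentence.symm ψ)).1 hθN
    rw [Subsingleton.elim ((default : Empty → N) ∘ isEmptyElim)
        fun a : (∅ : Set M) => (L.con a : N)] at hθN'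
    exact (Formula.realize_equivSentence_symm_con N ψ).1 hθN'
  obtain ⟨a, ha⟩ := hM ∅ (by simp [aleph0_pos]) n ((L[[(∅ : Set M)]].completeTheory M).typeOf b)
  refine ⟨a, typeOf_eq_typeOf_iff.2 fun φ => ?_⟩
  have h := typeOf_eq_typeOf_iff.1 ha ((L.lhomWithConstants (∅ : Set M)).onFormula φ)
  rwa [LHom.realize_onFormula, LHom.realize_onFormula] at h

theorem IsSaturated.exists_elementary_on_finset (hM : L.IsSaturated ℵ₀ M) (hT : T.IsComplete)
    (F : Finset N) : ∃ s : N → M, ∀ φ : L.Formula F,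
      φ.Realize (fun c : F => s c) ↔ φ.Realize (fun c : F => (c : N)) := by
  classical
  obtain ⟨a, ha⟩ := hM.exists_typeOf_eq hT fun j => ((F.equivFin.symm j : F) : N)
  obtain ⟨x⟩ := ‹Nonempty M›
  refine ⟨fun c => if h : c ∈ F then a (F.equivFin ⟨c, h⟩) else x, fun φ => ?_⟩
  have h := typeOf_eq_typeOf_iff.1 ha (φ.relabel F.equivFin)
  rw [Formula.realize_relabel, Formula.realize_relabel] at h
  simpa [Function.comp_def] using h

/-- Take `s F` elementary on the finite set `F`, and an ultrafilter containing every cone {F : A ⊆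
F}. A sentence or a tuple mentions only finitely many elements of `N`, so almost every `s F`
respects it. -/
theorem IsSaturated.exists_ultrafilter (hM : L.IsSaturated ℵ₀ M) (hT : T.IsComplete)
    (N : Type w'') [L.Structure N] [Nonempty N] [N ⊨ T] :
    ∃ (U : Ultrafilter (Finset N)) (s : Finset N → N → M),
      (∀ ψ ∈ L.elementaryDiagram N,
        ∀ᶠ F in U, (L.lhomWithConstantsMap (s F)).onSentence ψ ∈ L.elementaryDiagram M) ∧
      ∀ (m : ℕ) (b : Fin m → N), ∀ᶠ F in U, T.typeOf (s F ∘ b) = T.typeOf b := by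
  classical
  choose s hs using fun F : Finset N => hM.exists_elementary_on_finset hT F
  have hU : ∀ A : Finset N, ∀ᶠ F in (Ultrafilter.of (atTop : Filter (Finset N)) : Filter _),
      A ⊆ F := fun A => Ultrafilter.of_le _ (eventually_ge_atTop A)
  refine ⟨Ultrafilter.of atTop, s, fun ψ hψ => ?_, fun m b => ?_⟩
  · let θ : L.Formula N := Formula.equivSentence.symm ψ
    filter_upwards [hU θ.freeVarFinset] with F hF
    have h1 : θ.Realize (id : N → N) := (Formula.realize_equivSentence_symm_con N ψ).2 hψ
    have h2 := (BoundedFormula.realize_restrictFreeVar (φ := θ)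
      (f := fun c => (⟨c, hF c.2⟩ : F)) (v := fun c : F => (c : N)) id fun _ => rfl).2 h1
    have h3 := (BoundedFormula.realize_restrictFreeVar (φ := θ)
      (f := fun c => (⟨c, hF c.2⟩ : F)) (v := fun c : F => s F c) (s F) fun _ => rfl).1
      ((hs F _).2 h2)
    have h4 := (Formula.realize_equivSentence_symm M ψ (s F)).1 h3
    -- `M` becomes an `L[[N]]`-structure in which the constant `c` names `s F c`.
    let _ : (constantsOn N).Structure M := constantsOn.structure (s F)
    have : (LHom.constantsOnMap (s F)).IsExpansionOn M := constantsOnMap_isExpansionOn rfl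
    have : (L.lhomWithConstantsMap (s F)).IsExpansionOn M := LHom.sumMap_isExpansionOn _ _ M
    exact (LHom.realize_onSentence _ (L.lhomWithConstantsMap (s F)) ψ).2 h4
  · filter_upwards [hU (Finset.univ.image b)] with F hF
    refine typeOf_eq_typeOf_iff.2 fun φ => ?_
    have h := hs F (φ.relabel fun j => ⟨b j, hF (by simp)⟩)
    rwa [Formula.realize_relabel, Formula.realize_relabel] at h

theorem IsStronglyHomogeneous.exists_smul_eq (hM : L.IsStronglyHomogeneous ℵ₀ M) {m : ℕ}
    {a b : Fin m → M} (h : T.typeOf a = T.typeOf b) : ∃ σ : M ≃[L] M, σ ∘ a = b := by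
  rw [typeOf_eq_typeOf_iff] at h
  choose r hr using fun x : Set.range a => x.2
  -- The tuple `a` may have repetitions; equalities belong to the type, so sending `a i` to `b i` is
  -- well defined.
  have hrel : ∀ i j, a i = a j → b i = b j := by
    intro i j hij
    have := h ((Term.var i).equal (Term.var j))
    rw [Formula.realize_equal, Formula.realize_equal] at this
    exact this.1 hij
  obtain ⟨σ, hσ⟩ := hM (Set.range a) (Cardinal.lt_aleph0_iff_set_finite.2 (Set.finite_range a))
    (fun x => b (r x)) fun φ => by
      have := h (φ.relabel r)
      rw [Formula.realize_relabel, Formula.realize_relabel] at this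
      rwa [show a ∘ r = fun x : Set.range a => (x : M) from funext hr] at this
  refine ⟨σ, funext fun i => ?_⟩
  exact (hσ ⟨a i, i, rfl⟩).trans (hrel _ _ (hr _))

end Saturation

end FirstOrder.Language

namespace FirstOrder.Language

open TopDyn

/-! ### Neighbourhoods in the space of types -/

section TypeSpaceTopology

variable {L : Language.{u, v}} {I : Type w} {M : Type w'} [L.Structure M] {π : Set (L.Formula I)}

theorem TypeSpace.isOpen_has (ψ : L[[M]].Formula I) :
    IsOpen {p : TypeSpace M π | p.1.Has ψ} :=
  (CompleteType.isOpen_typesWith (Formula.equivSentence ψ)).preimage continuous_subtype_val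

theorem TypeSpace.eventually_has {ι : Type*} {F : Filter ι} {f : ι → TypeSpace M π}
    {p : TypeSpace M π} (hf : Tendsto f F (𝓝 p)) {m : ℕ} {φ : L.Formula (I ⊕ Fin m)}
    {b : Fin m → M} (hp : p.Has φ b) : ∀ᶠ i in F, (f i).Has φ b :=
  hf.eventually ((TypeSpace.isOpen_has (instFormula φ b)).mem_nhds hp)

theorem TypeSpace.exists_has_of_mem_nhds {p : TypeSpace M π} {t : Set (TypeSpace M π)}
    (ht : t ∈ 𝓝 p) : ∃ ψ : L[[M]].Formula I, p.1.Has ψ ∧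
      ∀ p' : TypeSpace M π, p'.1.Has ψ → p' ∈ t := by
  obtain ⟨t', ht', htt⟩ := mem_nhds_subtype _ p t |>.1 ht
  obtain ⟨_, ⟨χ, rfl⟩, hχ, hsub⟩ :=
    CompleteType.isTopologicalBasis_range_typesWith.mem_nhds_iff.1 ht'
  refine ⟨Formula.equivSentence.symm χ, ?_, fun p' hp' => htt (hsub ?_)⟩
  · rwa [TypeOver.Has, _root_.Equiv.apply_symm_apply]
  · rwa [TypeOver.Has, _root_.Equiv.apply_symm_apply] at hp'

/-- Neighbourhoods in the topology of pointwise convergence are determined by finitely many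
formulas with a common finite tuple of parameters. -/
theorem TypeSpace.exists_has_of_mem_nhds_pi [Nonempty M] {ι : Type*} {f : ι → TypeSpace M π}
    {t : Set (ι → TypeSpace M π)} (ht : t ∈ 𝓝 f) :
    ∃ (n : ℕ) (x : Fin n → ι) (m : ℕ) (φ : Fin n → L.Formula (I ⊕ Fin m)) (b : Fin m → M),
      (∀ k, (f (x k)).Has (φ k) b) ∧
      ∀ f' : ι → TypeSpace M π, (∀ k, (f' (x k)).Has (φ k) b) → f' ∈ t := by
  rw [nhds_pi, Filter.mem_pi] at ht
  obtain ⟨S, hS, t', ht', hsub⟩ := ht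
  choose ψ hψ hψ' using fun i => TypeSpace.exists_has_of_mem_nhds (ht' i)
  let e := hS.toFinset.equivFin
  obtain ⟨m, b, φ, hφ⟩ := TypeOver.exists_instFormula fun k => ψ (e.symm k)
  refine ⟨_, fun k => e.symm k, m, φ, b, fun k => (hφ k _).1 (hψ _), fun f' hf' => hsub ?_⟩
  intro i hi
  have h := (hφ (e ⟨i, hS.mem_toFinset.2 hi⟩) _).2 (hf' (e ⟨i, hS.mem_toFinset.2 hi⟩))
  simp only [_root_.Equiv.symm_apply_apply] at h
  exact hψ' i _ h

theorem TypeSpace.smul_has (σ : M ≃[L] M) (p : TypeSpace M π) {m : ℕ}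
    (φ : L.Formula (I ⊕ Fin m)) (b : Fin m → M) : (σ • p).Has φ (σ ∘ b) ↔ p.Has φ b :=
  p.1.smul_has_instFormula σ φ b

end TypeSpaceTopology

/-! ### Pattern homomorphisms and the Ellis semigroup -/

section PatternHom

variable {L : Language.{u, v}} (T : L.Theory) {I : Type w} {π : Set (L.Formula I)}
  {M : Type w'} [L.Structure M] [Nonempty M] [M ⊨ T]
  {N : Type w''} [L.Structure N] [Nonempty N] [N ⊨ T]

theorem typeOf_comp_aut (σ : M ≃[L] M) {m : ℕ} (b : Fin m → M) :
    T.typeOf (σ ∘ b) = T.typeOf b :=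
  typeOf_eq_typeOf_iff.2 fun φ => StrongHomClass.realize_formula σ φ

theorem content_smul {n : ℕ} (σ : M ≃[L] M) (p : Fin n → TypeSpace M π) :
    content T (fun i => σ • p i) = content T p := by
  have key : ∀ (σ : M ≃[L] M) (p : Fin n → TypeSpace M π),
      content T p ⊆ content T (fun i => σ • p i) := by
    rintro σ p z ⟨b, hb, h⟩
    exact ⟨σ ∘ b, (typeOf_comp_aut T σ b).trans hb, fun i => (TypeSpace.smul_has σ _ _ _).2 (h i)⟩
  refine Set.Subset.antisymm ?_ (key σ p)
  simpa using key σ⁻¹ fun i => σ • p i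

/-- The maps between type spaces that preserve infinitary definability patterns. -/
def IsPatternHom (f : TypeSpace M π → TypeSpace N π) : Prop :=
  ∀ (n : ℕ) (p : Fin n → TypeSpace M π), content T (f ∘ p) ⊆ content T p

variable {T}

theorem IsPatternHom.comp {K : Type*} [L.Structure K] [Nonempty K] [K ⊨ T]
    {g : TypeSpace N π → TypeSpace K π} {f : TypeSpace M π → TypeSpace N π}
    (hg : IsPatternHom T g) (hf : IsPatternHom T f) : IsPatternHom T (g ∘ f) :=
  fun n p => (hg n (f ∘ p)).trans (hf n p)

/-- Finitely many conditions φᵢ(x, b) ∈ η(pᵢ) are open in η, so some automorphism satisfies them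
too, and automorphisms preserve contents. -/
theorem isPatternHom_of_mem_ellisSemigroup {η : TypeSpace M π → TypeSpace M π}
    (hη : η ∈ ellisSemigroup (M ≃[L] M) (TypeSpace M π)) : IsPatternHom T η := by
  rintro n p z ⟨b, hb, h⟩
  have hev : ∀ᶠ f in 𝓝 η, ∀ i, (f (p i)).Has (z.2.1 i) b :=
    eventually_all.2 fun i =>
      TypeSpace.eventually_has ((continuous_apply (p i)).tendsto η) (h i)
  obtain ⟨_, hf, σ, rfl⟩ := mem_closure_iff_nhds.1 hη _ hev
  rw [← content_smul T σ p]
  exact ⟨b, hb, hf⟩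

/-- A basic neighbourhood of `f` asks for φₖ(x, b) at the points pₖ. The pattern property supplies a
tuple `a` of the type of `b` with φₖ(x, a) ∈ pₖ, and an automorphism taking `a` to `b` lies in the
neighbourhood. -/
theorem mem_ellisSemigroup_of_isPatternHom (hM : L.IsStronglyHomogeneous ℵ₀ M)
    {f : TypeSpace M π → TypeSpace M π} (hf : IsPatternHom T f) :
    f ∈ ellisSemigroup (M ≃[L] M) (TypeSpace M π) := by
  refine mem_closure_iff_nhds.2 fun t ht => ?_
  obtain ⟨n, p, m, φ, b, h, hsub⟩ := TypeSpace.exists_has_of_mem_nhds_pi ht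
  obtain ⟨a, ha, h'⟩ := hf n p (a := ⟨m, φ, T.typeOf b⟩) ⟨b, rfl, h⟩
  obtain ⟨σ, hσ⟩ := hM.exists_smul_eq ha
  refine ⟨_, hsub (fun p => σ • p) fun k => ?_, σ, rfl⟩
  rw [← hσ]
  exact (TypeSpace.smul_has σ (p k) (φ k) a).2 (h' k)

/-- The ultralimit of pullbacks along `s F` works: a pattern of the limit at `b` is a pattern of the
original types at `s F ∘ b` for almost all `F`, and almost always this tuple has the type of `b`. -/
theorem exists_isPatternHom (hT : T.IsComplete) (hM : L.IsSaturated ℵ₀ M)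
    (N : Type w'') [L.Structure N] [Nonempty N] [N ⊨ T] :
    ∃ f : TypeSpace M π → TypeSpace N π, IsPatternHom T f := by
  obtain ⟨U, s, hs, hs'⟩ := hM.exists_ultrafilter hT N
  refine ⟨fun p => ⟨p.1.ultralimit U s hs, fun φ hφ => ?_⟩, ?_⟩
  · refine (TypeOver.ultralimit_has U s hs p.1 _).2 (Eventually.of_forall fun F => ?_)
    have h1 := congrFun (LHom.comp_onBoundedFormula (α := I) (n := 0)
      (L.lhomWithConstantsMap (s F)) (L.lhomWithConstants N)) φ
    have h2 : (L.lhomWithConstantsMap (s F)).comp (L.lhomWithConstants N) =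
        L.lhomWithConstants M := LHom.map_constants_comp_sumInl L
    rw [h2] at h1
    have h3 := p.2 φ hφ
    rwa [show (L.lhomWithConstants M).onFormula φ = _ from h1] at h3
  · rintro n p z ⟨b, hb, h⟩
    have hev : ∀ᶠ F in U, ∀ i, (p i).Has (z.2.1 i) (s F ∘ b) := by
      refine eventually_all.2 fun i => ?_
      filter_upwards [(TypeOver.ultralimit_has U s hs (p i).1 _).1 (h i)] with F hF
      rwa [onFormula_instFormula] at hF
    obtain ⟨F, h1, h2⟩ := (hev.and (hs' _ b)).exists
    exact ⟨s F ∘ b, h2.trans hb, h1⟩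

end PatternHom

end FirstOrder.Language

/-! ### Algebra of minimal left ideals -/

namespace TopDyn.MinimalIdempotent

variable {G : Type*} {X : Type*} [Group G] [MulAction G X] [TopologicalSpace X]
  (c : MinimalIdempotent G X)

/-- By minimality ℳu = ℳ, and right multiplication by `u` fixes every element of ℳu. -/
theorem comp_u {η : X → X} (h : η ∈ c.ideal) : η ∘ c.u = η := by
  have hle : (fun a => a ∘ c.u) '' c.ideal ⊆ c.ideal := by
    rintro _ ⟨a, ha, rfl⟩
    exact c.isMinimal.prop.comp_mem _ (c.isMinimal.prop.subset ha) _ c.u_mem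
  have hI : IsLeftIdeal (ellisSemigroup G X) ((fun a => a ∘ c.u) '' c.ideal) := by
    refine ⟨⟨_, _, c.u_mem, rfl⟩, hle.trans c.isMinimal.prop.subset, ?_⟩
    rintro ζ hζ _ ⟨a, ha, rfl⟩
    exact ⟨ζ ∘ a, c.isMinimal.prop.comp_mem _ hζ _ ha, rfl⟩
  obtain ⟨a, -, rfl⟩ := c.isMinimal.le_of_le hI hle h
  exact congrArg (a ∘ ·) c.idem

/-- Removes the ideal from the description of uℳ, so that membership follows from absorbing `u` on
both sides. -/
theorem mem_ellisSet_iff {η : X → X} :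
    η ∈ c.ellisSet ↔ η ∈ ellisSemigroup G X ∧ c.u ∘ η = η ∧ η ∘ c.u = η := by
  refine ⟨fun h => ⟨c.isMinimal.prop.subset (c.ellisSet_subset h), c.u_comp h,
    c.comp_u (c.ellisSet_subset h)⟩, fun ⟨h, h1, h2⟩ => ⟨η, ?_, h1.symm⟩⟩
  rw [← h2]
  exact c.isMinimal.prop.comp_mem _ h _ c.u_mem

theorem eq_u_of_idem {η : X → X} (h : η ∈ c.ellisSet) (h' : η ∘ η = η) : η = c.u := by
  have h1 : (⟨η, h⟩ : c.EllisGroup) * ⟨η, h⟩ = ⟨η, h⟩ * 1 := by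
    rw [mul_one]
    exact EllisGroup.ext h'
  exact congrArg EllisGroup.map (mul_left_cancel h1)

theorem isClosed_iff {B : Set c.EllisGroup} :
    IsClosed B ↔ c.tauClosure (EllisGroup.map '' B) ⊆ EllisGroup.map '' B := by
  rw [← isOpen_compl_iff]
  change Bᶜᶜ ∈ {B | c.tauClosure (EllisGroup.map '' B) = EllisGroup.map '' B} ↔ _
  rw [compl_compl]
  exact ⟨fun h => Set.Subset.antisymm_iff.1 h |>.1,
    fun h => Set.Subset.antisymm h (c.subset_tauClosure (c.image_map_subset _))⟩

end TopDyn.MinimalIdempotent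

namespace FirstOrder.Language

open TopDyn

/-! ### Isomorphism of the cores -/

section Core

variable {L : Language.{u, v}} {T : L.Theory} {I : Type w} {π : Set (L.Formula I)}
  {M : Type w'} [L.Structure M] [Nonempty M] [M ⊨ T]
  {N : Type w''} [L.Structure N] [Nonempty N] [N ⊨ T]
  {c : MinimalIdempotent (M ≃[L] M) (TypeSpace M π)}
  {d : MinimalIdempotent (N ≃[L] N) (TypeSpace N π)}

theorem u_apply_core (p : core T c) : c.u p = p := by
  obtain ⟨_, q, rfl⟩ := p
  exact congrFun c.idem q

theorem isPatternHom_u : IsPatternHom T c.u :=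
  isPatternHom_of_mem_ellisSemigroup c.u_mem_ellis

/-- The isomorphism of cores induced by a pair of pattern homomorphisms that are inverse to each
other modulo the idempotents. -/
def coreEquiv {f : TypeSpace M π → TypeSpace N π} {g : TypeSpace N π → TypeSpace M π}
    (hf : IsPatternHom T f) (hg : IsPatternHom T g) (hdf : d.u ∘ f = f) (hcg : c.u ∘ g = g)
    (hgf : g ∘ f = c.u) (hfg : f ∘ g = d.u) : core T c ≃[ipLanguage T I] core T d where
  toFun p := ⟨f p, f p, congrFun hdf p⟩
  invFun q := ⟨g q, g q, congrFun hcg q⟩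
  left_inv p := Subtype.ext ((congrFun hgf p).trans (u_apply_core p))
  right_inv q := Subtype.ext ((congrFun hfg q).trans (u_apply_core q))
  map_fun' F := F.elim
  map_rel' {n} z p := by
    refine not_congr ⟨fun h => hf n (fun i => p i) h, fun h => ?_⟩
    -- `g` does not enlarge contents either, and `g ∘ f = c.u` is the identity on the core.
    refine hg n (fun i => f (p i)) ?_
    have : g ∘ (fun i => f (p i)) = fun i => (p i : TypeSpace M π) :=
      funext fun i => (congrFun hgf _).trans (u_apply_core (p i))
    rw [this]
    exact h

theorem isPatternHom_of_core (e : core T c ≃[ipLanguage T I] core T d) :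
    IsPatternHom T fun p : TypeSpace M π => (e ⟨c.u p, p, rfl⟩ : TypeSpace N π) := by
  intro n p z hz
  refine isPatternHom_u (c := c) n p ?_
  by_contra h
  exact (e.map_rel z fun i => ⟨c.u (p i), p i, rfl⟩).2 h hz

theorem nonempty_coreEquiv (hT : T.IsComplete)
    (hM : L.IsSaturated ℵ₀ M) (hM' : L.IsStronglyHomogeneous ℵ₀ M)
    (hN : L.IsSaturated ℵ₀ N) (hN' : L.IsStronglyHomogeneous ℵ₀ N)
    (c : MinimalIdempotent (M ≃[L] M) (TypeSpace M π))
    (d : MinimalIdempotent (N ≃[L] N) (TypeSpace N π)) :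
    Nonempty (core T c ≃[ipLanguage T I] core T d) := by
  obtain ⟨f₀, hf₀⟩ := exists_isPatternHom (π := π) hT hM N
  obtain ⟨g₀, hg₀⟩ := exists_isPatternHom (π := π) hT hN M
  have hu := isPatternHom_u (T := T) (c := c)
  have hv := isPatternHom_u (T := T) (c := d)
  have hf : IsPatternHom T (d.u ∘ f₀ ∘ c.u) := hv.comp (hf₀.comp hu)
  have hg : IsPatternHom T (c.u ∘ g₀ ∘ d.u) := hu.comp (hg₀.comp hv)
  have hcu : ∀ x, c.u (c.u x) = c.u x := congrFun c.idem
  have hdv : ∀ x, d.u (d.u x) = d.u x := congrFun d.idem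
  have hα : (c.u ∘ g₀ ∘ d.u) ∘ (d.u ∘ f₀ ∘ c.u) ∈ c.ellisSet :=
    c.mem_ellisSet_iff.2 ⟨mem_ellisSemigroup_of_isPatternHom hM' (hg.comp hf),
      funext fun x => by simp [hcu], funext fun x => by simp [hcu]⟩
  -- The inverse of this element in the group uℳ corrects the second map.
  let α : c.EllisGroup := ⟨_, hα⟩
  have hβ := c.mem_ellisSet_iff.1 α⁻¹.mem
  have hβα : ∀ x, α⁻¹.map (α.map x) = c.u x :=
    congrFun (congrArg MinimalIdempotent.EllisGroup.map (inv_mul_cancel α))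
  have hg' : IsPatternHom T (α⁻¹.map ∘ c.u ∘ g₀ ∘ d.u) :=
    (isPatternHom_of_mem_ellisSemigroup hβ.1).comp hg
  have hgf : (α⁻¹.map ∘ c.u ∘ g₀ ∘ d.u) ∘ (d.u ∘ f₀ ∘ c.u) = c.u := funext hβα
  have hfu : (d.u ∘ f₀ ∘ c.u) ∘ c.u = d.u ∘ f₀ ∘ c.u := funext fun x => by simp [hcu]
  refine ⟨coreEquiv hf hg' (funext fun x => by simp [hdv]) (funext fun x => ?_) hgf ?_⟩
  · exact congrFun hβ.2.1 _
  -- With g the corrected map, fgfg = fug = fg, an idempotent in a group.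
  · refine d.eq_u_of_idem (d.mem_ellisSet_iff.2
      ⟨mem_ellisSemigroup_of_isPatternHom hN' (hf.comp hg'),
        funext fun x => by simp [hdv], funext fun x => by simp [hdv]⟩) ?_
    funext x
    exact (congrArg (d.u ∘ f₀ ∘ c.u) (congrFun hgf _)).trans (congrFun hfu _)

end Core

/-! ### The Ellis group as the automorphism group of the core -/

section Restriction

variable {L : Language.{u, v}} {T : L.Theory} {I : Type w} {π : Set (L.Formula I)}
  {M : Type w'} [L.Structure M] [Nonempty M] [M ⊨ T]
  {c : MinimalIdempotent (M ≃[L] M) (TypeSpace M π)}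

variable (T c) in
/-- The restriction of an element of the Ellis group to the core. -/
noncomputable def ellisRestrict (η : c.EllisGroup) : core T c ≃[ipLanguage T I] core T c :=
  coreEquiv (isPatternHom_of_mem_ellisSemigroup (c.mem_ellisSet_iff.1 η.mem).1)
    (isPatternHom_of_mem_ellisSemigroup (c.mem_ellisSet_iff.1 η⁻¹.mem).1)
    (c.u_comp η.mem) (c.u_comp η⁻¹.mem)
    (congrArg MinimalIdempotent.EllisGroup.map (inv_mul_cancel η))
    (congrArg MinimalIdempotent.EllisGroup.map (mul_inv_cancel η))

theorem map_u_apply (η : c.EllisGroup) (p : TypeSpace M π) : η.map (c.u p) = η.map p :=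
  congrFun (c.mem_ellisSet_iff.1 η.mem).2.2 p

/-- Restriction to the core is an isomorphism of the Ellis group with the group of automorphisms
of the core. -/
noncomputable def ellisMulEquiv (hM : L.IsStronglyHomogeneous ℵ₀ M)
    (c : MinimalIdempotent (M ≃[L] M) (TypeSpace M π)) :
    c.EllisGroup ≃* (core T c ≃[ipLanguage T I] core T c) where
  toFun := ellisRestrict T c
  invFun f := ⟨fun p => (f ⟨c.u p, p, rfl⟩ : TypeSpace M π), c.mem_ellisSet_iff.2
    ⟨mem_ellisSemigroup_of_isPatternHom hM (isPatternHom_of_core f),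
      funext fun p => u_apply_core (f _),
      funext fun p => congrArg (fun q => (f q : TypeSpace M π))
        (Subtype.ext (congrFun c.idem p))⟩⟩
  left_inv η := MinimalIdempotent.EllisGroup.ext (funext fun p => map_u_apply η p)
  right_inv f := by
    ext p
    exact congrArg (fun q => (f q : TypeSpace M π)) (Subtype.ext (u_apply_core p))
  map_mul' η θ := by
    ext p
    rfl

theorem mem_ippClosed_iff {J : (ipLanguage T I).Substructure (TypeSpace M π)} {m n : ℕ}
    {R : (ipLanguage T I).Relations (m + n)} {p : Fin m → J} {q : Fin n → J}
    {f : J ≃[ipLanguage T I] J} :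
    f ∈ ippClosed R p q ↔ R ∉ content T
      (Fin.append (fun i => (f (p i) : TypeSpace M π)) fun j => (q j : TypeSpace M π)) := by
  refine not_congr (iff_of_eq (congrArg (fun P => R ∈ content T P) (funext fun k => ?_)))
  refine k.addCases (fun i => ?_) fun j => ?_
  · simp only [Fin.append_left]
  · simp only [Fin.append_right]

/-- Let σb → η and σ → u. If the relation fails at (η(p), q), a witness for the failure persists at
(σb(p), σq), because u(q) = q on the core. Invariance of contents under σ makes the relation fail
already at (b(p), q). -/
theorem continuous_ellisRestrict : Continuous (ellisRestrict T c) := by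
  refine continuous_generateFrom_iff.2 ?_
  rintro _ ⟨m, n, R, p, q, rfl⟩
  rw [Set.preimage_compl, isOpen_compl_iff, c.isClosed_iff]
  rintro η ⟨hη, F, hF, hB, h1, h2⟩
  refine ⟨⟨η, hη⟩, ?_, rfl⟩
  refine mem_ippClosed_iff.2 ?_
  rintro ⟨b, hb, hP⟩
  let Q : (M ≃[L] M) × (TypeSpace M π → TypeSpace M π) → Fin (m + n) → TypeSpace M π :=
    fun z => Fin.append (fun i => z.2 (p i)) fun j => (q j : TypeSpace M π)
  have hev : ∀ᶠ z in F, ∀ k, (z.1 • Q z k).Has (R.2.1 k) b := by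
    refine eventually_all.2 fun k => ?_
    refine TypeSpace.eventually_has ?_ (hP k)
    refine k.addCases (fun i => ?_) fun j => ?_
    · simp only [Q, Fin.append_left]
      exact (tendsto_pi_nhds.1 h2) _
    · simp only [Q, Fin.append_right]
      have := (tendsto_pi_nhds.1 h1) (q j)
      rwa [u_apply_core] at this
  obtain ⟨z, hz, θ, hθ, hzθ⟩ := (hev.and hB).exists
  refine mem_ippClosed_iff.1 hθ ?_
  have hmem : R ∈ content T (Q z) := by
    rw [← content_smul T z.1 (Q z)]
    exact ⟨b, hb, hz⟩
  simp only [Q, ← hzθ] at hmem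
  exact hmem

/-- For η outside `B`, a basic neighbourhood of (u, η) missing all (σ, σb) is coded by a single
relation; its failure at the pair of blocks (f(y), y) is an ipp-open condition that holds at η and
excludes `B`. -/
theorem isClosed_preimage_ellisMulEquiv_symm (hM : L.IsStronglyHomogeneous ℵ₀ M) {B : Set c.EllisGroup}
    (hB : IsClosed B) : IsClosed ((ellisMulEquiv (T := T) hM c).symm ⁻¹' B) := by
  rw [← isOpen_compl_iff, isOpen_iff_forall_mem_open]
  intro f hf
  obtain ⟨η, rfl⟩ := (ellisMulEquiv (T := T) hM c).surjective f
  have hη : η ∉ B := fun h => hf (by simpa using h)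
  have hcl : η.map ∉ circ (M ≃[L] M) c.u (MinimalIdempotent.EllisGroup.map '' B) := by
    intro h
    obtain ⟨θ, hθ, hθη⟩ := c.isClosed_iff.1 hB ⟨η.mem, h⟩
    exact hη (MinimalIdempotent.EllisGroup.ext hθη ▸ hθ)
  -- a neighbourhood of `(u, η)` that contains no pair `(σ, σ b)` with `b ∈ B`
  let E : (M ≃[L] M) × (TypeSpace M π → TypeSpace M π) →
      TypeSpace M π ⊕ TypeSpace M π → TypeSpace M π :=
    fun z => Sum.elim (fun x => z.1 • x) fun x => z.1 • z.2 x
  obtain ⟨t, ht, hdisj⟩ : ∃ t ∈ 𝓝 (Sum.elim c.u η.map), ∀ z,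
      z.2 ∈ MinimalIdempotent.EllisGroup.map '' B → E z ∉ t := by
    by_contra! hcon
    -- Otherwise the pairs themselves, filtered by the neighbourhoods they reach, form a net putting
    -- η in u ∘ B.
    refine hcl ⟨comap E (𝓝 (Sum.elim c.u η.map)) ⊓
      𝓟 {z | z.2 ∈ MinimalIdempotent.EllisGroup.map '' B}, ?_, ?_, ?_, ?_⟩
    · refine inf_principal_neBot_iff.2 fun s hs => ?_
      obtain ⟨t, ht, hts⟩ := mem_comap.1 hs
      obtain ⟨z, hz, hzt⟩ := hcon t ht
      exact ⟨z, hts hzt, hz⟩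
    · exact mem_inf_of_right (mem_principal_self _)
    · have h := (tendsto_comap (f := E) (x := 𝓝 (Sum.elim c.u η.map)))
      exact (tendsto_pi_nhds.2 fun x => tendsto_pi_nhds.1 h (Sum.inl x)).mono_left inf_le_left
    · have h := (tendsto_comap (f := E) (x := 𝓝 (Sum.elim c.u η.map)))
      exact (tendsto_pi_nhds.2 fun x => tendsto_pi_nhds.1 h (Sum.inr x)).mono_left inf_le_left
  obtain ⟨n, x, m, φ, b, hx, hsub⟩ := TypeSpace.exists_has_of_mem_nhds_pi ht
  let y : Fin n → core T c := fun k => ⟨c.u (Sum.elim id id (x k)), _, rfl⟩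
  -- Conditions on η go to the first block and conditions on `u` to the second; `⊤` fills the unused
  -- places.
  let R : (ipLanguage T I).Relations (n + n) := ⟨m, Fin.append
    (fun k => Sum.elim (fun _ => ⊤) (fun _ => φ k) (x k))
    (fun k => Sum.elim (fun _ => φ k) (fun _ => ⊤) (x k)), T.typeOf b⟩
  refine ⟨(ippClosed R y y)ᶜ, ?_, TopologicalSpace.isOpen_generateFrom_of_mem
    ⟨n, n, R, y, y, rfl⟩, ?_⟩
  · intro f hfR hfB
    obtain ⟨θ, rfl⟩ := (ellisMulEquiv (T := T) hM c).surjective f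
    have hθ : θ ∈ B := by simpa using hfB
    refine hfR (mem_ippClosed_iff.2 fun hcon => ?_)
    -- remove the idempotent from the second block
    have hcon' : R ∈ content T (Fin.append (fun k => θ.map (Sum.elim id id (x k)))
        fun k => Sum.elim id id (x k)) := by
      refine isPatternHom_u (c := c) _ _ ?_
      refine cast (congrArg (fun P => R ∈ content T P) (funext fun k => ?_)) hcon
      -- The first block is unaffected, since θu = θ = uθ.
      refine k.addCases (fun i => ?_) fun j => ?_
      · simp only [Function.comp, Fin.append_left]
        exact (map_u_apply θ _).trans (congrFun (c.u_comp θ.mem) _).symm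
      · simp only [Function.comp, Fin.append_right]
        rfl
    obtain ⟨a, ha, h⟩ := hcon'
    obtain ⟨σ, hσ⟩ := hM.exists_smul_eq (T := T) ha
    -- Moving the witness `a` to `b` by σ puts (σ, σθ) in the excluded neighbourhood.
    refine hdisj (σ, θ.map) ⟨θ, hθ, rfl⟩ (hsub _ fun k => ?_)
    rw [← hσ]
    have h1 := h (Fin.castAdd n k)
    have h2 := h (Fin.natAdd n k)
    simp only [R, Fin.append_left, Fin.append_right] at h1 h2
    rcases hk : x k with z | z
    · rw [hk] at h2
      exact (TypeSpace.smul_has σ _ _ _).2 h2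
    · rw [hk] at h1
      exact (TypeSpace.smul_has σ _ _ _).2 h1
  · intro hcon
    refine mem_ippClosed_iff.1 hcon ⟨b, rfl, fun k => ?_⟩
    refine k.addCases (fun i => ?_) fun j => ?_
    · simp only [R, Fin.append_left]
      have hi := hx i
      rcases hk : x i with z | z
      · exact TypeOver.has_top _ _
      · rw [hk] at hi
        have : ((ellisMulEquiv (T := T) hM c η (y i) : core T c) : TypeSpace M π) = η.map z := by
          refine (map_u_apply η _).trans ?_
          rw [hk]
          rfl
        rw [this]
        exact hi
    · simp only [R, Fin.append_right]
      have hj := hx j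
      rcases hk : x j with z | z
      · rw [hk] at hj
        have : (y j : TypeSpace M π) = c.u z := by
          simp only [y, hk]
          rfl
        rw [this]
        exact hj
      · exact TypeOver.has_top _ _

/-- Restriction to the core is a homeomorphism of the Ellis group with the τ-topology and the
group of automorphisms of the core with the ipp-topology. -/
noncomputable def ellisContinuousMulEquiv (hM : L.IsStronglyHomogeneous ℵ₀ M)
    (c : MinimalIdempotent (M ≃[L] M) (TypeSpace M π)) :
    c.EllisGroup ≃ₜ* (core T c ≃[ipLanguage T I] core T c) where
  toMulEquiv := ellisMulEquiv hM c
  continuous_toFun := continuous_ellisRestrict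
  continuous_invFun := continuous_iff_isClosed.2 fun _ hB => isClosed_preimage_ellisMulEquiv_symm hM hB

end Restriction

/-! ### Transport of the ipp-topology along isomorphisms -/

section Conjugation

variable {L : Language.{u, v}} {T : L.Theory} {I : Type w} {π : Set (L.Formula I)}
  {M : Type w'} [L.Structure M] [Nonempty M] [M ⊨ T]
  {N : Type w''} [L.Structure N] [Nonempty N] [N ⊨ T]

theorem continuous_conj {J : (ipLanguage T I).Substructure (TypeSpace M π)}
    {J' : (ipLanguage T I).Substructure (TypeSpace N π)} (e : J ≃[ipLanguage T I] J') :
    Continuous fun f : J ≃[ipLanguage T I] J => e.comp (f.comp e.symm) := by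
  refine continuous_generateFrom_iff.2 ?_
  rintro _ ⟨m, n, R, p, q, rfl⟩
  refine TopologicalSpace.isOpen_generateFrom_of_mem
    ⟨m, n, R, fun i => e.symm (p i), fun j => e.symm (q j), ?_⟩
  rw [Set.preimage_compl]
  refine congrArg compl (Set.ext fun f => ?_)
  -- Applying `e.symm` to all arguments turns a subbasic set for `J'` into one for `J`.
  refine Iff.trans (b := Structure.RelMap R (e ∘ Fin.append (fun i => f (e.symm (p i)))
    fun j => e.symm (q j))) ?_ (e.map_rel R _)
  change Structure.RelMap R (Fin.append (fun i => e (f (e.symm (p i)))) q) ↔ _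
  refine iff_of_eq (congrArg (Structure.RelMap R) (funext fun k => ?_))
  refine k.addCases (fun i => ?_) fun j => ?_
  · simp only [Function.comp, Fin.append_left]
  · simp only [Function.comp, Fin.append_right, Equiv.apply_symm_apply]

/-- Isomorphic pattern structures have isomorphic automorphism groups, with the ipp-topologies. -/
def conjContinuousMulEquiv {J : (ipLanguage T I).Substructure (TypeSpace M π)}
    {J' : (ipLanguage T I).Substructure (TypeSpace N π)} (e : J ≃[ipLanguage T I] J') :
    (J ≃[ipLanguage T I] J) ≃ₜ* (J' ≃[ipLanguage T I] J') where
  toFun f := e.comp (f.comp e.symm)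
  invFun f := e.symm.comp (f.comp e)
  left_inv f := by
    ext p
    simp
  right_inv f := by
    ext p
    simp
  map_mul' f g := by
    refine Equiv.ext fun p => ?_
    change e (f (g (e.symm p))) = e (f (e.symm (e (g (e.symm p)))))
    rw [e.symm_apply_apply]
  continuous_toFun := continuous_conj e
  continuous_invFun := continuous_conj e.symm

end Conjugation

end FirstOrder.Language

/-! ### The main theorem -/

theorem mainTheorem7 {L : FirstOrder.Language.{u, v}} (T : L.Theory) (hT : T.IsComplete)
    {I : Type w} (π : Set (L.Formula I))
    (M : Type w') [L.Structure M] [Nonempty M] [M ⊨ T]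
    (hM : L.IsSaturated ℵ₀ M) (hM' : L.IsStronglyHomogeneous ℵ₀ M)
    (N : Type w'') [L.Structure N] [Nonempty N] [N ⊨ T]
    (hN : L.IsSaturated ℵ₀ N) (hN' : L.IsStronglyHomogeneous ℵ₀ N)
    (c : TopDyn.MinimalIdempotent (M ≃[L] M) (Language.TypeSpace M π))
    (d : TopDyn.MinimalIdempotent (N ≃[L] N) (Language.TypeSpace N π)) :
    Nonempty (Language.core T c ≃[Language.ipLanguage T I] Language.core T d) ∧
    (∃ δ : c.EllisGroup ≃ₜ* (Language.core T c ≃[Language.ipLanguage T I] Language.core T c),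
      ∀ (η : c.EllisGroup) (p : Language.core T c),
        (δ η p : Language.TypeSpace M π) = η.map p) ∧
    Nonempty (c.EllisGroup ≃ₜ* d.EllisGroup) := by
  obtain ⟨e⟩ := Language.nonempty_coreEquiv hT hM hM' hN hN' c d
  exact ⟨⟨e⟩, ⟨Language.ellisContinuousMulEquiv hM' c, fun _ _ => rfl⟩,
    ⟨(Language.ellisContinuousMulEquiv hM' c).trans ((Language.conjContinuousMulEquiv e).trans
      (Language.ellisContinuousMulEquiv hN' d).symm)⟩⟩
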